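/- Consider a finite sporadic task system scheduled by preemptive fixed-priority scheduling on one processor. Each task $\tau_i$ has a worst-case execution time $C_i\ge 0$, a period (minimum inter-arrival time) $T_i>0$ and a relative deadline $D_i>0$, where deadlines are arbitrary (no relation between $D_i$ and $T_i$ is assumed), and distinct tasks have distinct priorities. Every job of $\tau_i$ needs at most $C_i$ units of execution, the jobs of one task execute in sequence, and $U_i=C_i/T_i$. Let $\tau_k$ be a task with $C_k>0$. Let $hp_1(\tau_k)$ (respectively $hp_2(\tau_k)$) be the set of tasks with higher priority than $\tau_k$ and with period $T_i<D_k$ (respectively $T_i\ge D_k$), and put $$C_k'=\left\lceil \frac{D_k}{T_k}\right\rceil C_k+\sum_{\tau_i\in hp_2(\tau_k)}C_i .$$ Let the $k^*-1$ tasks of $hp_1(\tau_k)$ be indexed by $1,\dots,k^*-1$ in a non-decreasing order of $\left(\left\lceil D_k/T_i\right\rceil-1\right)T_i$. **Theorem.** If $\sum_{i=1}^{k^*-1}\frac{C_i}{D_k}\le 1$ and $$\frac{C_k'}{D_k}\le 1-\sum_{i=1}^{k^*-1}U_i-\sum_{i=1}^{k^*-1}\frac{C_i}{D_k}+\frac{\sum_{i=1}^{k^*-1}U_i\left(\sum_{\ell=i}^{k^*-1}C_\ell\right)}{D_k},$$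 then $\tau_k$ is schedulable, i.e. in every fixed-priority schedule of every legal job sequence of the system, every job of $\tau_k$ finishes within $D_k$ time units after its release. -/

import Mathlib

open MeasureTheory

noncomputable section

/-- A sporadic task system with arbitrary relative deadlines and fixed task priorities.
For each task `i`: `C i` is its worst-case execution time, `T i` its period (minimum
inter-arrival time), `D i` its relative deadline, and `prio i` its priority level, where a
smaller number means a higher priority. -/
structure SporadicTaskSystem (ι : Type*) where
  C : ι → ℝ
  T : ι → ℝ
  D : ι → ℝ
  prio : ι → ℕ
  C_nonneg : ∀ i, 0 ≤ C i
  T_pos : ∀ i, 0 < T i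
  D_pos : ∀ i, 0 < D i
  prio_injective : Function.Injective prio

/-- A uniprocessor schedule of the jobs `(i, j)` (the `j`-th job of task `i`, `j = 0, 1, …`)
in continuous time: at each instant the processor executes one job, or idles (`none`). -/
abbrev UniSchedule (ι : Type*) := ℝ → Option (ι × ℕ)

/-- The amount of processor time that job `J` receives in `[0, t)`. -/
def UniSchedule.service {ι : Type*} (σ : UniSchedule ι) (J : ι × ℕ) (t : ℝ) : ℝ :=
  volume.real {s : ℝ | 0 ≤ s ∧ s < t ∧ σ s = some J}

namespace SporadicTaskSystem

variable {ι : Type*}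

/-- A legal job sequence of the task system: job `(i, j)` is released at time `r i j` and needs
`c i j` units of execution. The system starts at time `0`, successive releases of task `i`
are separated by at least `T i`, and no job executes longer than `C i`. -/
structure IsJobSequence (S : SporadicTaskSystem ι) (r c : ι → ℕ → ℝ) : Prop where
  release_nonneg : ∀ i j, 0 ≤ r i j
  separation : ∀ i j, r i j + S.T i ≤ r i (j + 1)
  cost_nonneg : ∀ i j, 0 ≤ c i j
  cost_le : ∀ i j, c i j ≤ S.C i

/-- Job `(i, j)` has received all the execution that it needs by time `t`. -/
def FinishedBy (c : ι → ℕ → ℝ) (σ : UniSchedule ι) (i : ι) (j : ℕ) (t : ℝ) : Prop :=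
  c i j ≤ σ.service (i, j) t

/-- Job `(i, j)` is in the ready queue at time `t`: it has been released, it is not finished,
and all the earlier jobs of the same task are finished (the jobs of one task execute in
sequence). -/
def Ready (r c : ι → ℕ → ℝ) (σ : UniSchedule ι) (i : ι) (j : ℕ) (t : ℝ) : Prop :=
  r i j ≤ t ∧ ¬ FinishedBy c σ i j t ∧ ∀ j' < j, FinishedBy c σ i j' t

/-- `σ` is a schedule that the preemptive fixed-priority scheduler produces on one processor
for the given job sequence: at every instant it executes a job of highest priority among the
jobs in the ready queue, and it idles only if the ready queue is empty. -/
structure IsFixedPrioritySchedule (S : SporadicTaskSystem ι) (r c : ι → ℕ → ℝ)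
    (σ : UniSchedule ι) : Prop where
  measurable : ∀ J : ι × ℕ, MeasurableSet {s : ℝ | σ s = some J}
  run_ready : ∀ t, 0 ≤ t → ∀ i j, σ t = some (i, j) → Ready r c σ i j t
  run_highest : ∀ t, 0 ≤ t → ∀ i j, σ t = some (i, j) →
    ∀ i' j', Ready r c σ i' j' t → S.prio i ≤ S.prio i'
  idle : ∀ t, 0 ≤ t → σ t = none → ∀ i j, ¬ Ready r c σ i j t

/-- Task `k` is schedulable by preemptive fixed-priority scheduling on one processor: in every
schedule of every legal job sequence of the system, each job of task `k` is finished by its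
absolute deadline, `D k` time units after its release. -/
def Schedulable (S : SporadicTaskSystem ι) (k : ι) : Prop :=
  ∀ r c : ι → ℕ → ℝ, S.IsJobSequence r c →
    ∀ σ : UniSchedule ι, S.IsFixedPrioritySchedule r c σ →
      ∀ j, FinishedBy c σ k j (r k j + S.D k)

/-- The utilization of task `i`. -/
def U (S : SporadicTaskSystem ι) (i : ι) : ℝ := S.C i / S.T i

/-- The tasks with higher priority than `k` whose period is smaller than `D k`. -/
def hp₁ [Fintype ι] (S : SporadicTaskSystem ι) (k : ι) : Finset ι :=
  {i | S.prio i < S.prio k ∧ S.T i < S.D k}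

/-- The tasks with higher priority than `k` whose period is at least `D k`. -/
def hp₂ [Fintype ι] (S : SporadicTaskSystem ι) (k : ι) : Finset ι :=
  {i | S.prio i < S.prio k ∧ S.D k ≤ S.T i}

/-- The inflated execution time `C_k' = ⌈D_k / T_k⌉ C_k + ∑_{i ∈ hp₂(k)} C_i`. -/
def inflatedC [Fintype ι] (S : SporadicTaskSystem ι) (k : ι) : ℝ :=
  (⌈S.D k / S.T k⌉ : ℝ) * S.C k + ∑ i ∈ S.hp₂ k, S.C i

/-- The last release time `(⌈D_k / T_i⌉ - 1) T_i` of task `i` before `D_k`. -/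
def lastRelease (S : SporadicTaskSystem ι) (k i : ι) : ℝ :=
  ((⌈S.D k / S.T i⌉ : ℝ) - 1) * S.T i

end SporadicTaskSystem

end

/-! The proof has a scheduling half and an arithmetic half. Scheduling (`schedulable_of_demand_le`):
let `a` be the last quiet time up to the release of a job of `k`. If some `t ≤ D k` bounds the
level-`k` demand of a window of length `t`, another quiet time occurs in `(a, a + t]`. By maximality
of `a` it lies after the release, so the job is finished by then, within `D k` of its release.

Arithmetic (`exists_le_of_quadratic_bound`): only `t = D k` and the points `t_i = lastRelease k i`
are tested. At `t_b` the demand is at most `A + ∑_{l<b} C_l`, with `A = C_k' + ∑ t_i U_i`. If every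
test fails, weighting the failures at `t_i` by `U_i` and summing gives `A (1 - ∑ U_i) ≤ C_k' + ∑ U_i
∑_{l<i} C_l`, which the hypothesis bounds by `(D - ∑ C_i)(1 - ∑ U_i)`. Failure at `D` says `D - ∑
C_i < A`, a contradiction. -/

namespace UniSchedule

variable {ι : Type*} (σ : UniSchedule ι) (J : ι × ℕ)

/-- The processor time that a job receives in a bounded window is finite. -/
theorem volume_window_ne_top (a t : ℝ) :
    volume {s : ℝ | a ≤ s ∧ s < t ∧ σ s = some J} ≠ ⊤ :=
  measure_ne_top_of_subset (s := Set.Ico a t) (fun _ hs => ⟨hs.1, hs.2.1⟩) (by simp)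

theorem service_mono : Monotone (σ.service J) := fun _ t hst =>
  measureReal_mono (fun _ hx => ⟨hx.1, hx.2.1.trans_le hst, hx.2.2⟩)
    (σ.volume_window_ne_top J 0 t)

theorem service_zero : σ.service J 0 = 0 := by
  have : {s : ℝ | 0 ≤ s ∧ s < 0 ∧ σ s = some J} = ∅ := by
    ext s
    simp only [Set.mem_ofPred_eq, Set.mem_empty_iff_false, iff_false]
    rintro ⟨h1, h2, -⟩
    linarith
  simp [service, this]

/-- The service received up to `t` is at most the service received up to `s`, plus the time
that the job receives in `[s, t)`. -/
theorem service_le_add (s t : ℝ) :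
    σ.service J t ≤ σ.service J s + volume.real {x : ℝ | s ≤ x ∧ x < t ∧ σ x = some J} := by
  refine (measureReal_mono (fun x hx => ?_) ?_).trans (measureReal_union_le _ _)
  · rcases lt_or_ge x s with h | h
    · exact Or.inl ⟨hx.1, h, hx.2.2⟩
    · exact Or.inr ⟨h, hx.2⟩
  · exact (measure_union_lt_top (σ.volume_window_ne_top J 0 s).lt_top
      (σ.volume_window_ne_top J s t).lt_top).ne

theorem service_le_add_sub {s t : ℝ} (hst : s ≤ t) :
    σ.service J t ≤ σ.service J s + (t - s) := by
  refine (σ.service_le_add J s t).trans (add_le_add le_rfl ?_)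
  have : volume.real {x : ℝ | s ≤ x ∧ x < t ∧ σ x = some J} ≤ volume.real (Set.Ico s t) :=
    measureReal_mono (fun _ hx => ⟨hx.1, hx.2.1⟩) (by simp)
  simpa [Real.volume_real_Ico_of_le hst] using this

theorem continuous_service : Continuous (σ.service J) := by
  refine (LipschitzWith.of_le_add fun s t => ?_).continuous
  rcases le_total t s with h | h
  · rw [Real.dist_eq, abs_of_nonneg (sub_nonneg.2 h)]
    exact σ.service_le_add_sub J h
  · exact (σ.service_mono J h).trans (le_add_of_nonneg_right dist_nonneg)

/-- A job that runs only while its service is below `c` never receives more than `c`. -/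
theorem service_le_of_run {c : ℝ} (hc : 0 ≤ c)
    (hrun : ∀ s, 0 ≤ s → σ s = some J → σ.service J s < c) {t : ℝ} (ht : 0 ≤ t) :
    σ.service J t ≤ c := by
  by_contra! hlt
  -- At `u` the service equals `c` exactly, so the job cannot run from `u` on.
  obtain ⟨u, ⟨hu0, -⟩, hu⟩ := intermediate_value_Icc ht (σ.continuous_service J).continuousOn
    (show c ∈ Set.Icc (σ.service J 0) (σ.service J t) from
      ⟨(σ.service_zero J).trans_le hc, hlt.le⟩)
  have hempty : {x : ℝ | u ≤ x ∧ x < t ∧ σ x = some J} = ∅ := by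
    refine Set.eq_empty_of_forall_notMem fun x hx => ?_
    have h1 := hrun x (hu0.trans hx.1) hx.2.2
    have h2 := σ.service_mono J hx.1
    linarith
  have h := σ.service_le_add J u t
  rw [hempty, measureReal_empty] at h
  linarith

end UniSchedule

/-! ### Quiet times and the time-demand test -/

namespace SporadicTaskSystem

variable {ι : Type*} {S : SporadicTaskSystem ι} {r c : ι → ℕ → ℝ} {σ : UniSchedule ι}

theorem IsJobSequence.release_add_le (h : S.IsJobSequence r c) (i : ι) (j n : ℕ) :
    r i j + n * S.T i ≤ r i (j + n) := by
  induction n with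
  | zero => simp
  | succ n ih =>
    have h1 := h.separation i (j + n)
    rw [← add_assoc]
    push_cast
    linarith

theorem IsJobSequence.release_mono (h : S.IsJobSequence r c) (i : ι) : Monotone (r i) :=
  monotone_nat_of_le_succ fun j => by
    have h1 := h.separation i j
    have h2 := S.T_pos i
    linarith

theorem IsJobSequence.exists_le_release (h : S.IsJobSequence r c) (i : ι) (a : ℝ) :
    ∃ j, a ≤ r i j := by
  obtain ⟨n, hn⟩ := exists_nat_ge (a / S.T i)
  refine ⟨n, ?_⟩
  have h1 := h.release_add_le i 0 n
  rw [zero_add] at h1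
  have h2 := h.release_nonneg i 0
  rw [div_le_iff₀ (S.T_pos i)] at hn
  linarith

/-- The jobs of one task released in `[a, a + t)` lie in a block of `⌈t / T i⌉` indices. -/
theorem IsJobSequence.exists_block (h : S.IsJobSequence r c) (i : ι) (a t : ℝ) :
    ∃ p : ℕ, ∀ j, a ≤ r i j → r i j < a + t → j ∈ Finset.Ico p (p + ⌈t / S.T i⌉₊) := by
  classical
  have hex := h.exists_le_release i a
  refine ⟨Nat.find hex, fun j hj hjt => Finset.mem_Ico.2 ⟨Nat.find_min' hex hj, ?_⟩⟩
  by_contra! hle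
  have h1 := h.release_mono i hle
  have h2 := h.release_add_le i (Nat.find hex) ⌈t / S.T i⌉₊
  have h3 := Nat.find_spec hex
  have h4 := (div_le_iff₀ (S.T_pos i)).1 (Nat.le_ceil (t / S.T i))
  linarith

theorem FinishedBy.mono {i : ι} {j : ℕ} {s t : ℝ} (h : FinishedBy c σ i j s) (hst : s ≤ t) :
    FinishedBy c σ i j t :=
  le_trans h (σ.service_mono _ hst)

theorem IsFixedPrioritySchedule.service_le_cost (hσ : S.IsFixedPrioritySchedule r c σ)
    (h : S.IsJobSequence r c) (i : ι) (j : ℕ) {t : ℝ} (ht : 0 ≤ t) :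
    σ.service (i, j) t ≤ c i j :=
  σ.service_le_of_run _ (h.cost_nonneg i j)
    (fun s hs hrun => not_le.1 (hσ.run_ready s hs i j hrun).2.1) ht

/-- `q` is a quiet time at the priority level of `k`: every job of priority at least that of `k`
released before `q` is finished by `q`. -/
def Quiet (S : SporadicTaskSystem ι) (r c : ι → ℕ → ℝ) (σ : UniSchedule ι) (k : ι)
    (q : ℝ) : Prop :=
  ∀ i j, S.prio i ≤ S.prio k → r i j < q → FinishedBy c σ i j q

/-- While work of the level of `k` is pending, the processor executes work of that level. -/
theorem IsFixedPrioritySchedule.exists_run_of_not_quiet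
    (hσ : S.IsFixedPrioritySchedule r c σ) (h : S.IsJobSequence r c) {k : ι} {s : ℝ}
    (hs : 0 ≤ s) (hq : ¬ S.Quiet r c σ k s) :
    ∃ i j, S.prio i ≤ S.prio k ∧ σ s = some (i, j) := by
  classical
  simp only [Quiet, not_forall] at hq
  obtain ⟨i, j, hi, hj, hf⟩ := hq
  have hex : ∃ j, ¬ FinishedBy c σ i j s := ⟨j, hf⟩
  -- The earliest unfinished job of the task is ready, although job `j` itself may still be blocked
  -- by it.
  have hready : Ready r c σ i (Nat.find hex) s :=
    ⟨(h.release_mono i (Nat.find_min' hex hf)).trans hj.le, Nat.find_spec hex,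
      fun j' hj' => not_not.1 (Nat.find_min hex hj')⟩
  rcases hrun : σ s with - | ⟨i', j'⟩
  · exact absurd hready (hσ.idle s hs hrun _ _)
  · exact ⟨i', j', (hσ.run_highest s hs i' j' hrun _ _ hready).trans hi, rfl⟩

/-- The quiet times up to `b` have a greatest element. -/
theorem IsJobSequence.exists_last_quiet (h : S.IsJobSequence r c) (σ : UniSchedule ι) (k : ι)
    {b : ℝ} (hb : 0 ≤ b) :
    ∃ a, 0 ≤ a ∧ a ≤ b ∧ S.Quiet r c σ k a ∧ ∀ s, a < s → s ≤ b → ¬ S.Quiet r c σ k s := by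
  set Q : Set ℝ := {q | 0 ≤ q ∧ q ≤ b ∧ S.Quiet r c σ k q} with hQ
  have h0 : (0 : ℝ) ∈ Q :=
    ⟨le_rfl, hb, fun i j _ hj => absurd hj (not_lt.2 (h.release_nonneg i j))⟩
  have hbdd : BddAbove Q := ⟨b, fun q hq => hq.2.1⟩
  refine ⟨sSup Q, le_csSup hbdd h0, csSup_le ⟨0, h0⟩ fun q hq => hq.2.1, ?_, ?_⟩
  · intro i j hi hj
    obtain ⟨q, hq, hjq⟩ := exists_lt_of_lt_csSup ⟨0, h0⟩ hj
    exact (hq.2.2 i j hi hjq).mono (le_csSup hbdd hq)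
  · intro s hs hsb hsq
    exact absurd (le_csSup hbdd ⟨(le_csSup hbdd h0).trans hs.le, hsb, hsq⟩) (not_le.2 hs)

/-- If the work of the level of `k` that can be released in a window of length `t` fits into
the window, then a quiet time `a` is followed by another quiet time in `(a, a + t]`. -/
theorem IsFixedPrioritySchedule.exists_quiet_of_demand_le [Fintype ι]
    (hσ : S.IsFixedPrioritySchedule r c σ) (h : S.IsJobSequence r c) {k : ι} {a t : ℝ}
    (ha : 0 ≤ a) (ht : 0 < t) (hqa : S.Quiet r c σ k a)
    (hdem : ∑ i with S.prio i ≤ S.prio k, (⌈t / S.T i⌉₊ : ℝ) * S.C i ≤ t) :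
    ∃ s, a < s ∧ s ≤ a + t ∧ S.Quiet r c σ k s := by
  classical
  by_contra! hno
  choose p hp using fun i => h.exists_block i a t
  set F : Finset (Σ _ : ι, ℕ) := (Finset.univ.filter fun i => S.prio i ≤ S.prio k).sigma
    fun i => Finset.Ico (p i) (p i + ⌈t / S.T i⌉₊) with hF
  -- Without a quiet time the processor never leaves level `k`, and jobs released before `a` are
  -- already finished, so only jobs of `F` run.
  have hcover : Set.Ioo a (a + t) ⊆
      ⋃ x ∈ F, {s : ℝ | 0 ≤ s ∧ s < a + t ∧ σ s = some (x.1, x.2)} := by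
    intro s hs
    have hs0 : 0 ≤ s := ha.trans hs.1.le
    obtain ⟨i, j, hi, hrun⟩ := hσ.exists_run_of_not_quiet h hs0 (hno s hs.1 hs.2.le)
    have hready := hσ.run_ready s hs0 i j hrun
    have haj : a ≤ r i j := by
      by_contra! hlt
      exact hready.2.1 ((hqa i j hi hlt).mono hs.1.le)
    refine Set.mem_biUnion (x := (⟨i, j⟩ : Σ _ : ι, ℕ)) ?_ ⟨hs0, hs.2, hrun⟩
    exact Finset.mem_coe.2 (Finset.mem_sigma.2
      ⟨by simpa using hi, hp i j haj (hready.1.trans_lt hs.2)⟩)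
  have hsupply : t ≤ ∑ x ∈ F, σ.service (x.1, x.2) (a + t) := by
    have h1 : volume.real (Set.Ioo a (a + t)) = t := by
      rw [Real.volume_real_Ioo_of_le (by linarith)]
      ring
    calc t = volume.real (Set.Ioo a (a + t)) := h1.symm
      _ ≤ _ := measureReal_mono hcover
          (measure_biUnion_lt_top F.finite_toSet
            fun x _ => (σ.volume_window_ne_top (x.1, x.2) 0 (a + t)).lt_top).ne
      _ ≤ _ := measureReal_biUnion_finset_le _ _
  have hle : ∀ x ∈ F, σ.service (x.1, x.2) (a + t) ≤ S.C x.1 := fun x _ =>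
    (hσ.service_le_cost h x.1 x.2 (by linarith)).trans (h.cost_le x.1 x.2)
  have hcap : ∑ x ∈ F, S.C x.1 ≤ t := by
    rw [hF, Finset.sum_sigma]
    simpa using hdem
  -- The supply `t` is at most the total service, which is at most the total cost, at most `t`. An
  -- unfinished job would make this chain strict, so `a + t` is quiet.
  refine hno (a + t) (by linarith) le_rfl fun i j hi hj => ?_
  rcases lt_or_ge (r i j) a with hja | hja
  · exact (hqa i j hi hja).mono (by linarith)
  · by_contra hf
    have hmem : (⟨i, j⟩ : Σ _ : ι, ℕ) ∈ F :=
      Finset.mem_sigma.2 ⟨by simpa using hi, hp i j hja hj⟩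
    have := Finset.sum_lt_sum hle ⟨_, hmem, (not_le.1 hf).trans_le (h.cost_le i j)⟩
    linarith

/-- Time-demand test for arbitrary deadlines: if the level-`k` demand of some window of length
`t ≤ D k` fits into it, then no level-`k` busy period is longer than `D k`. -/
theorem schedulable_of_demand_le [Fintype ι] {k : ι} {t : ℝ} (ht : 0 < t) (htD : t ≤ S.D k)
    (hdem : ∑ i with S.prio i ≤ S.prio k, (⌈t / S.T i⌉₊ : ℝ) * S.C i ≤ t) :
    S.Schedulable k := by
  intro r c h σ hσ j
  by_contra hf
  obtain ⟨a, ha0, har, hqa, hlast⟩ := h.exists_last_quiet σ k (h.release_nonneg k j)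
  obtain ⟨s, has, hst, hqs⟩ := hσ.exists_quiet_of_demand_le h ha0 ht hqa hdem
  rcases le_or_gt s (r k j) with hs | hs
  · exact hlast s has hs hqs
  · exact hf ((hqs k j le_rfl hs).mono (by linarith))

/-- The level-`k` demand of a window of length `t ≤ D k`, split by the kind of task. -/
theorem demand_le_inflatedC_add [Fintype ι] {k : ι} {t : ℝ} (ht : 0 < t) (htD : t ≤ S.D k) :
    ∑ i with S.prio i ≤ S.prio k, (⌈t / S.T i⌉₊ : ℝ) * S.C i ≤
      S.inflatedC k + ∑ i ∈ S.hp₁ k, (⌈t / S.T i⌉ : ℝ) * S.C i := by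
  classical
  have hsplit : (Finset.univ.filter fun i => S.prio i ≤ S.prio k) =
      insert k (S.hp₂ k ∪ S.hp₁ k) := by
    ext i
    simp only [hp₁, hp₂, Finset.mem_filter, Finset.mem_univ, true_and, Finset.mem_insert,
      Finset.mem_union]
    constructor
    · intro hi
      rcases hi.eq_or_lt with hi | hi
      · exact Or.inl (S.prio_injective hi)
      · exact Or.inr ((le_or_gt (S.D k) (S.T i)).imp (⟨hi, ·⟩) (⟨hi, ·⟩))
    · rintro (rfl | hi | hi)
      exacts [le_rfl, hi.1.le, hi.1.le]
  have hk : k ∉ S.hp₂ k ∪ S.hp₁ k := by simp [hp₁, hp₂]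
  have hdisj : Disjoint (S.hp₂ k) (S.hp₁ k) := Finset.disjoint_left.2 fun i h2 h1 => by
    simp only [hp₁, hp₂, Finset.mem_filter] at h1 h2
    linarith [h1.2.2, h2.2.2]
  have hceil : ∀ i, (⌈t / S.T i⌉₊ : ℝ) = (⌈t / S.T i⌉ : ℝ) := fun i =>
    natCast_ceil_eq_intCast_ceil (div_pos ht (S.T_pos i)).le
  rw [hsplit, Finset.sum_insert hk, Finset.sum_union hdisj, inflatedC, ← add_assoc]
  simp only [hceil]
  gcongr with i hi
  · exact S.C_nonneg k
  · exact (S.T_pos k).le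
  · have hi2 : S.D k ≤ S.T i := by
      simp only [hp₂, Finset.mem_filter] at hi
      exact hi.2.2
    have : ⌈t / S.T i⌉ ≤ 1 := Int.ceil_le.2 (by
      rw [Int.cast_one, div_le_one (S.T_pos i)]
      linarith)
    exact mul_le_of_le_one_left (S.C_nonneg i) (by exact_mod_cast this)

/-! ### Demand at the test points -/

theorem lastRelease_mul_U (S : SporadicTaskSystem ι) (k i : ι) :
    S.lastRelease k i * S.U i = ((⌈S.D k / S.T i⌉ : ℝ) - 1) * S.C i := by
  have := (S.T_pos i).ne'
  unfold lastRelease U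
  field_simp

/-- A period below `D k` forces the ceiling to be at least 2; this makes the test point a window of
positive length. -/
theorem lastRelease_pos {k i : ι} (h : S.T i < S.D k) : 0 < S.lastRelease k i := by
  refine mul_pos (sub_pos.2 ?_) (S.T_pos i)
  exact_mod_cast Int.lt_ceil.2 (by rwa [Int.cast_one, one_lt_div (S.T_pos i)])

theorem lastRelease_lt (S : SporadicTaskSystem ι) (k i : ι) : S.lastRelease k i < S.D k := by
  rw [lastRelease, ← lt_div_iff₀ (S.T_pos i)]
  linarith [Int.ceil_lt_add_one (S.D k / S.T i)]

theorem ceil_mul_le_of_le_deadline {k i : ι} {t : ℝ} (ht : t ≤ S.D k) :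
    (⌈t / S.T i⌉ : ℝ) * S.C i ≤ S.lastRelease k i * S.U i + S.C i := by
  have h1 : (⌈t / S.T i⌉ : ℝ) ≤ ⌈S.D k / S.T i⌉ := by
    exact_mod_cast Int.ceil_mono (div_le_div_of_nonneg_right ht (S.T_pos i).le)
  rw [lastRelease_mul_U]
  nlinarith [mul_le_mul_of_nonneg_right h1 (S.C_nonneg i)]

/-- Up to its last release before `D k`, a task contributes one job fewer, which saves the extra `C
i` of `ceil_mul_le_of_le_deadline`. -/
theorem ceil_mul_le_of_le_lastRelease {k i : ι} {t : ℝ} (ht : t ≤ S.lastRelease k i) :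
    (⌈t / S.T i⌉ : ℝ) * S.C i ≤ S.lastRelease k i * S.U i := by
  rw [lastRelease_mul_U]
  refine mul_le_mul_of_nonneg_right ?_ (S.C_nonneg i)
  have : ⌈t / S.T i⌉ ≤ ⌈S.D k / S.T i⌉ - 1 := Int.ceil_le.2 (by
    rw [div_le_iff₀ (S.T_pos i)]
    push_cast
    exact ht)
  exact_mod_cast this

theorem inflatedC_pos [Fintype ι] {k : ι} (hCk : 0 < S.C k) : 0 < S.inflatedC k := by
  have h1 : 0 < ⌈S.D k / S.T k⌉ := Int.ceil_pos.2 (div_pos (S.D_pos k) (S.T_pos k))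
  exact add_pos_of_pos_of_nonneg (mul_pos (by exact_mod_cast h1) hCk)
    (Finset.sum_nonneg fun i _ => S.C_nonneg i)

end SporadicTaskSystem

/-- The quadratic bound: under it, one of the test points `t a` or `D` dominates its demand. -/
theorem exists_le_of_quadratic_bound {m : ℕ} {t u w : Fin m → ℝ} {D W : ℝ} (hW : 0 < W)
    (hu : ∀ a, 0 ≤ u a) (hw0 : ∀ a, 0 ≤ w a) (hw : ∑ a, w a ≤ D)
    (hQ : W ≤ D - D * ∑ a, u a - ∑ a, w a + ∑ a, u a * ∑ l ∈ Finset.Ici a, w l) :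
    (W + ∑ a, t a * u a + ∑ a, w a ≤ D) ∨
      ∃ b, W + ∑ a, t a * u a + ∑ a ∈ Finset.Iio b, w a ≤ t b := by
  by_contra! hcon
  obtain ⟨hD, ht⟩ := hcon
  set A := W + ∑ a, t a * u a with hA
  have hsplit : ∀ a, ∑ l ∈ Finset.Ici a, w l = ∑ l, w l - ∑ l ∈ Finset.Iio a, w l := by
    intro a
    rw [eq_sub_iff_add_eq', ← Finset.sum_union]
    · congr 1
      ext l
      simp [lt_or_ge]
    · exact Finset.disjoint_left.2 fun l h1 h2 =>
        absurd (Finset.mem_Iio.1 h1) (not_lt.2 (Finset.mem_Ici.1 h2))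
  -- Passing from tail sums to initial sums makes the quadratic bound factor.
  have hQ' : W + ∑ a, u a * ∑ l ∈ Finset.Iio a, w l ≤ (D - ∑ a, w a) * (1 - ∑ a, u a) := by
    have h1 : ∑ a, u a * ∑ l ∈ Finset.Ici a, w l =
        (∑ a, u a) * ∑ l, w l - ∑ a, u a * ∑ l ∈ Finset.Iio a, w l := by
      rw [Finset.sum_mul, ← Finset.sum_sub_distrib]
      exact Finset.sum_congr rfl fun a _ => by rw [hsplit, mul_sub]
    rw [h1] at hQ
    linarith
  have hsum : ∑ a, t a * u a ≤ A * ∑ a, u a + ∑ a, u a * ∑ l ∈ Finset.Iio a, w l := by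
    rw [Finset.mul_sum, ← Finset.sum_add_distrib]
    exact Finset.sum_le_sum fun a _ => by nlinarith [mul_le_mul_of_nonneg_right (ht a).le (hu a)]
  have hlow : 0 ≤ ∑ a, u a * ∑ l ∈ Finset.Iio a, w l :=
    Finset.sum_nonneg fun a _ => mul_nonneg (hu a) (Finset.sum_nonneg fun l _ => hw0 l)
  -- The product in `hQ'` is at least `W > 0` and its first factor is nonnegative by `hw`.
  have hu1 : 0 < 1 - ∑ a, u a :=
    pos_of_mul_pos_right (by linarith) (sub_nonneg.2 hw)
  have := mul_lt_mul_of_pos_right (sub_lt_iff_lt_add.2 hD) hu1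
  linarith

theorem mainTheorem8 {ι : Type*} [Fintype ι] (S : SporadicTaskSystem ι) (k : ι)
    (hCk : 0 < S.C k)
    (m : ℕ) (e : Fin m ≃ {i : ι // i ∈ S.hp₁ k})
    (he : ∀ a b : Fin m, a ≤ b → S.lastRelease k (e a) ≤ S.lastRelease k (e b))
    (hC : ∑ a : Fin m, S.C (e a) / S.D k ≤ 1)
    (hQ : S.inflatedC k / S.D k ≤
      1 - ∑ a : Fin m, S.U (e a) - ∑ a : Fin m, S.C (e a) / S.D k
        + (∑ a : Fin m, S.U (e a) * ∑ l ∈ Finset.Ici a, S.C (e l)) / S.D k) :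
    S.Schedulable k := by
  have hD := S.D_pos k
  have hsum : ∀ f : ι → ℝ, ∑ i ∈ S.hp₁ k, f i = ∑ a : Fin m, f (e a) := fun f => by
    rw [← Finset.sum_coe_sort, ← e.sum_comp]
  have hmem : ∀ a : Fin m, S.T (e a) < S.D k := fun a => by
    have := (e a).2
    simp only [SporadicTaskSystem.hp₁, Finset.mem_filter] at this
    exact this.2.2
  rw [← Finset.sum_div] at hC hQ
  rw [div_le_one hD] at hC
  have hQ' : S.inflatedC k ≤ S.D k - S.D k * ∑ a : Fin m, S.U (e a) - ∑ a : Fin m, S.C (e a)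
      + ∑ a : Fin m, S.U (e a) * ∑ l ∈ Finset.Ici a, S.C (e l) := by
    rw [div_le_iff₀ hD] at hQ
    refine hQ.trans_eq ?_
    field_simp
  rcases exists_le_of_quadratic_bound (t := fun a => S.lastRelease k (e a))
    (SporadicTaskSystem.inflatedC_pos hCk)
    (fun a => div_nonneg (S.C_nonneg (e a)) (S.T_pos (e a)).le)
    (fun a => S.C_nonneg (e a)) hC hQ' with h | ⟨b, h⟩
  · refine SporadicTaskSystem.schedulable_of_demand_le hD le_rfl
      ((SporadicTaskSystem.demand_le_inflatedC_add hD le_rfl).trans (le_trans ?_ h))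
    rw [hsum, add_assoc, ← Finset.sum_add_distrib]
    gcongr with a
    exact SporadicTaskSystem.ceil_mul_le_of_le_deadline le_rfl
  · have hb := S.lastRelease_lt k (e b)
    have hb0 := SporadicTaskSystem.lastRelease_pos (hmem b)
    refine SporadicTaskSystem.schedulable_of_demand_le hb0 hb.le
      ((SporadicTaskSystem.demand_le_inflatedC_add hb0 hb.le).trans (le_trans ?_ h))
    have hind : ∑ a ∈ Finset.Iio b, S.C (e a) = ∑ a, if a < b then S.C (e a) else 0 := by
      rw [← Finset.sum_filter]
      congr 1
      ext
      simp
    rw [hsum, add_assoc, hind, ← Finset.sum_add_distrib]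
    gcongr with a
    split_ifs with hab
    · exact SporadicTaskSystem.ceil_mul_le_of_le_deadline hb.le
    · rw [add_zero]
      -- The ordering enters only here: for `b ≤ a` the test point of `b` does not exceed that of
      -- `a`.
      exact SporadicTaskSystem.ceil_mul_le_of_le_lastRelease (he b a (not_lt.1 hab))
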